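/- Let $d,n,n_0\in\mathbb N$ with $2\le n_0\le n$, let $\eta>0$, and let $\mathcal H$ be the Paley–Wiener space with parameter $\eta$: the continuous real functions in $L^2(\mathbb R^d)$ whose ($L^2$-)Fourier transform is supported in the hypercube $[-\eta,\eta]^d$ of angular frequencies, with the norm $\|f\|_{\mathcal H}=\|f\|_{L^2}$. Suppose that - $y_k=f_*(x_k)+\varepsilon_k$ for $k=1,\dots,n$, the pairs $(x_k,y_k)\in\mathbb R^d\times\mathbb R$ are i.i.d., and $\mathbb E[y_k^2]<\infty$; - the inputs $x_k$ have a density $h_*$ with $h_*(x)>0$ for all $x\in\mathbb R^d$; - $\mathbb E[\varepsilon_k]=0$, $\varepsilon_k$ is independent of $x_k$ for every $k$, and $(\varepsilon_1,\dots,\varepsilon_n)$ has the same law as $G(\varepsilon_1,\dots,\varepsilon_n)^{\mathrm T}$ for every $G$ in a given compact matrix group $\mathcal G$; - $f_*\in\mathcal H$, and $f_*^2(x)\le\varrho\,h_*(x)$ for all $x\in\mathbb R^d$, with a constant $\varrho>0$. Let $\alpha\in(0,1)$, $\beta\in[0,1)$, and let $\mathcal Z\subseteq\mathbb R^{n_0}$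 be a random (possibly degenerate) ellipsoid, that is, $\mathcal Z=\{c+Au:\|u\|_2\le1\}$ with a random vector $c$ and a random matrix $A$, such that $\mathbb P\big((f_*(x_1),\dots,f_*(x_{n_0}))^{\mathrm T}\in\mathcal Z\big)\ge1-\beta$. For $z,v\in\mathbb R^{n_0}$ put $$T(z)=\Big(\tfrac{z_1^2}{h_*(x_1)},\dots,\tfrac{z_{n_0}^2}{h_*(x_{n_0})}\Big),\qquad V_{n_0}(v)=\frac1{n_0(n_0-1)}\sum_{1\le i\le j\le n_0}(v_i-v_j)^2,\qquad \xi^*=\max_{z\in\mathcal Z}\frac1{n_0}\sum_{k=1}^{n_0}\frac{z_k^2}{h_*(x_k)},$$ and $$\psi(\kappa,\alpha,m,v)=\sqrt{\frac{2v\ln(2/\alpha)}{m}}+\kappa\,\frac{7\ln(2/\alpha)}{3(m-1)}.$$ Then the maximum $\xi^*$ is attained and $z\mapsto V_{n_0}(T(z))$ has a maximizer on $\mathcal Z$. For every choice of a maximizer $z^*\in\mathcal Z$ of $V_{n_0}(T(z))$, $$\tau_e=\xi^*+\psi\big(\varrho,\alpha,n_0,V_{n_0}(T(z^*))\big)\quad\text{satisfies}\quad\mathbb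 P\big(\|f_*\|_{\mathcal H}^2\le\tau_e\big)\ge1-\alpha-\beta .$$ If there is no noise ($\varepsilon_k=0$ almost surely for all $k$), then also, with $y=(y_1,\dots,y_{n_0})$, $$\tau_b=\xi^*+\psi\big(\varrho,\alpha,n_0,V_{n_0}(T(y))\big)\quad\text{satisfies}\quad\mathbb P\big(\|f_*\|_{\mathcal H}^2\le\tau_b\big)\ge1-\alpha-\beta .$$ If $\varrho\ge1$, both bounds hold as well with $\psi$ replaced by $\tilde\psi(\kappa,\alpha,m,v)=\kappa\Big(\sqrt{\frac{2v\ln(2/\alpha)}{m}}+\frac{7\ln(2/\alpha)}{3(m-1)}\Big)$. -/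

import Mathlib

open MeasureTheory ProbabilityTheory
open scoped FourierTransform Matrix

noncomputable section

namespace KernelNormBound

/-- The input space `ℝ^d`, with Lebesgue measure as `volume`. -/
abbrev Inputs (d : ℕ) : Type := EuclideanSpace ℝ (Fin d)

/-- `f : ℝ^d → ℝ` belongs to the Paley-Wiener space with parameter `η`: it is the continuous
representative of an element of `L²(ℝ^d)` whose `L²`-Fourier transform vanishes a.e. outside the
hypercube `[-η, η]^d` of angular frequencies. Mathlib's Fourier transform has the character
`exp (-2πi⟨x, ξ⟩)`, so that the angular frequency of `ξ` is `2πξ`. -/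
structure IsPaleyWiener {d : ℕ} (η : ℝ) (f : Inputs d → ℝ) : Prop where
  continuous : Continuous f
  memLp : MemLp f 2 volume
  spectrum : ∀ᵐ ξ : Inputs d, (∃ j, η < |2 * Real.pi * ξ j|) →
    (𝓕 (MemLp.toLp (fun s => (f s : ℂ)) memLp.ofReal : Lp ℂ 2 (volume : Measure (Inputs d)))) ξ = 0

/-- The kernel norm of a Paley-Wiener function: the norm inherited from `L²(ℝ^d)`. -/
def kernelNorm {d : ℕ} (f : Inputs d → ℝ) : ℝ := (eLpNorm f 2 volume).toReal

/-- The random vector `ε` is distributionally invariant with respect to the compact matrix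
group `G`. -/
structure IsInvariantUnder {Ω : Type*} [MeasurableSpace Ω] {n : ℕ} (P : Measure Ω)
    (ε : Fin n → Ω → ℝ) (G : Subgroup (GL (Fin n) ℝ)) : Prop where
  compact : IsCompact (G : Set (GL (Fin n) ℝ))
  invariant : ∀ g ∈ G,
    IdentDistrib (fun ω => (g : Matrix (Fin n) (Fin n) ℝ) *ᵥ (fun k => ε k ω))
      (fun ω k => ε k ω) P P

/-- The regression model: an i.i.d. sample `(x_k, y_k)` with `y_k = f (x_k) + ε_k`, square
integrable outputs, inputs with an everywhere positive density `h`, centered noises independent of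
the inputs and invariant under the group `G`, and a Paley-Wiener function `f` with
`f² ≤ ϱ h`. -/
structure IsRegressionModel {Ω : Type*} [MeasurableSpace Ω] {d n : ℕ} (P : Measure Ω)
    (η ϱ : ℝ) (f h : Inputs d → ℝ) (x : Fin n → Ω → Inputs d) (y ε : Fin n → Ω → ℝ)
    (G : Subgroup (GL (Fin n) ℝ)) : Prop where
  output_eq : ∀ k ω, y k ω = f (x k ω) + ε k ω
  -- the sample is i.i.d., with square integrable outputs
  measurable_input : ∀ k, Measurable (x k)
  measurable_output : ∀ k, Measurable (y k)
  indep : iIndepFun (fun k ω => (x k ω, y k ω)) P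
  identDistrib : ∀ k l, IdentDistrib (fun ω => (x k ω, y k ω)) (fun ω => (x l ω, y l ω)) P P
  sq_integrable : ∀ k, Integrable (fun ω => y k ω ^ 2) P
  -- the inputs have a positive density
  measurable_density : Measurable h
  density_pos : ∀ s, 0 < h s
  law_input : ∀ k, P.map (x k) = volume.withDensity (fun s => ENNReal.ofReal (h s))
  -- the noises
  noise_mean : ∀ k, Integrable (ε k) P ∧ ∫ ω, ε k ω ∂P = 0
  noise_indep : ∀ k, IndepFun (ε k) (x k) P
  noise_invariant : IsInvariantUnder P ε G
  -- the regression function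
  paleyWiener : IsPaleyWiener η f
  bound_pos : 0 < ϱ
  sq_le : ∀ s, f s ^ 2 ≤ ϱ * h s

/-- The (possibly degenerate) ellipsoid with center `c` and shape matrix `A`: the image of the
closed Euclidean unit ball under `u ↦ c + A u`. -/
def ellipsoid {m : ℕ} (c : Fin m → ℝ) (A : Matrix (Fin m) (Fin m) ℝ) : Set (Fin m → ℝ) :=
  {z | ∃ u : Fin m → ℝ, ∑ i, u i ^ 2 ≤ 1 ∧ z = c + A *ᵥ u}

/-- `Z` is a random ellipsoid: its center and its shape matrix are random variables. -/
def IsRandomEllipsoid {Ω : Type*} [MeasurableSpace Ω] {m : ℕ} (Z : Ω → Set (Fin m → ℝ)) : Prop :=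
  ∃ (c : Ω → Fin m → ℝ) (A : Ω → Matrix (Fin m) (Fin m) ℝ),
    Measurable c ∧ (∀ i j, Measurable fun ω => A ω i j) ∧ ∀ ω, Z ω = ellipsoid (c ω) (A ω)

/-- `T(z) = (z₁² / h(x₁), …, z_m² / h(x_m))`. -/
def importanceVec {d m : ℕ} (h : Inputs d → ℝ) (x : Fin m → Inputs d) (z : Fin m → ℝ) :
    Fin m → ℝ :=
  fun k => z k ^ 2 / h (x k)

/-- The mean `M(v)` of a vector. -/
def vecMean {m : ℕ} (v : Fin m → ℝ) : ℝ := (1 / (m : ℝ)) * ∑ i, v i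

/-- The empirical variance `V_m(v) = (1 / (m (m - 1))) ∑_{i ≤ j} (v_i - v_j)²`. -/
def empVar {m : ℕ} (v : Fin m → ℝ) : ℝ :=
  (1 / ((m : ℝ) * ((m : ℝ) - 1))) *
    ∑ p : Fin m × Fin m with p.1 ≤ p.2, (v p.1 - v p.2) ^ 2

/-- `ξ*`: the optimal value of the maximization of `M(T(z))` subject to `z ∈ Z`. -/
def xiStar {d m : ℕ} (h : Inputs d → ℝ) (x : Fin m → Inputs d) (Z : Set (Fin m → ℝ)) : ℝ :=
  sSup ((fun z => vecMean (importanceVec h x z)) '' Z)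

/-- `z` is an optimal solution of the maximization of `V_m(T(z))` subject to `z ∈ Z`. -/
def IsVarMaximizer {d m : ℕ} (h : Inputs d → ℝ) (x : Fin m → Inputs d) (Z : Set (Fin m → ℝ))
    (z : Fin m → ℝ) : Prop :=
  z ∈ Z ∧ ∀ w ∈ Z, empVar (importanceVec h x w) ≤ empVar (importanceVec h x z)

/-- The empirical Bernstein term for variables with values in `[0, κ]` and empirical variance
`v`. -/
def psi (κ α : ℝ) (m : ℕ) (v : ℝ) : ℝ :=
  √(2 * v * Real.log (2 / α) / m) + κ * (7 * Real.log (2 / α) / (3 * ((m : ℝ) - 1)))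

/-- The variant of the empirical Bernstein term in which the factor `κ` also multiplies the
square root; it is at least `psi` when `κ ≥ 1`. -/
def psiScaled (κ α : ℝ) (m : ℕ) (v : ℝ) : ℝ :=
  κ * (√(2 * v * Real.log (2 / α) / m) + 7 * Real.log (2 / α) / (3 * ((m : ℝ) - 1)))

end KernelNormBound

end

/-! Importance sampling turns the norm into a mean: since `h` is the density of the inputs, the
variables `f (x k) ^ 2 / h (x k)` have expectation `‖f‖²` (`integral_importanceRatio`). They are
i.i.d. with values in `[0, ϱ]`, so the empirical Bernstein inequality bounds `‖f‖²` by their sample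
mean plus `psi` of their empirical variance, outside an event of probability at most `α`. The exact
values of `f` are unknown, but with probability at least `1 - β` they form a point of `Z`. There
`ξ*` dominates their mean and the maximizer `z*` dominates their empirical variance; `psi` is
monotone in the variance, and a union bound concludes. The empirical Bernstein inequality is proved
from scratch. `measure_mean_le_le` controls the mean through the true variance,
`measure_empVar_le_le` controls the true standard deviation through the empirical one, and each may
fail with probability `α / 2`. The empirical variance is not a sum of independent terms; it is an
average over permutations of such sums, and Jensen's inequality reduces its Laplace transform to
theirs. -/

namespace KernelNormBound

/-! ### Scalar bounds for the exponential -/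

section ExponentialInequalities

/-- Since `2 * 3 ^ n ≤ (n + 2)!`, the Taylor tail from degree two on is dominated by a geometric
series of ratio `|u| / 3`. -/
lemma exp_le_of_abs_lt_three {u : ℝ} (hu : |u| < 3) :
    Real.exp u ≤ 1 + u + u ^ 2 / (2 * (1 - |u| / 3)) := by
  have hexp : HasSum (fun n : ℕ => u ^ n / (n.factorial : ℝ)) (Real.exp u) := by
    rw [Real.exp_eq_exp_ℝ]
    exact NormedSpace.expSeries_div_hasSum_exp u
  have htail := (hasSum_nat_add_iff' 2).mpr hexp
  have hgeom : HasSum (fun n : ℕ => u ^ 2 / 2 * (|u| / 3) ^ n)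
      (u ^ 2 / 2 * (1 - |u| / 3)⁻¹) :=
    (hasSum_geometric_of_lt_one (by positivity) (by linarith)).mul_left _
  have hle := hasSum_le (fun n => ?_) htail hgeom
  · have h1 : u ^ 2 / (2 * (1 - |u| / 3)) = u ^ 2 / 2 * (1 - |u| / 3)⁻¹ := by
      rw [div_mul_eq_div_div, div_eq_mul_inv (u ^ 2 / 2)]
    rw [h1]
    simp only [Finset.sum_range_succ, Finset.sum_range_zero, pow_zero, pow_one,
      Nat.factorial_zero, Nat.factorial_one, Nat.cast_one, div_one, zero_add] at hle
    linarith
  · have hfac : (2 * 3 ^ n : ℝ) ≤ ((n + 2).factorial : ℝ) := by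
      have := @Nat.factorial_mul_pow_le_factorial 2 n
      rw [add_comm 2 n] at this
      exact_mod_cast this
    calc u ^ (n + 2) / ((n + 2).factorial : ℝ)
        ≤ |u| ^ (n + 2) / ((n + 2).factorial : ℝ) := by
          rw [← abs_pow]
          exact div_le_div_of_nonneg_right (le_abs_self _) (by positivity)
      _ ≤ |u| ^ (n + 2) / (2 * 3 ^ n) := by gcongr
      _ = u ^ 2 / 2 * (|u| / 3) ^ n := by
          rw [pow_add, sq_abs, div_pow]
          field_simp

/-- Follows from `1 + u + u²/2 ≤ exp u`, because `(1 - u + u²/2) (1 + u + u²/2) = 1 + u⁴/4 ≥ 1`. -/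
lemma exp_neg_le_quadratic {u : ℝ} (hu : 0 ≤ u) : Real.exp (-u) ≤ 1 - u + u ^ 2 / 2 := by
  have h := Real.quadratic_le_exp_of_nonneg hu
  have hpos : 0 < 1 - u + u ^ 2 / 2 := by nlinarith [sq_nonneg (u - 1)]
  rw [Real.exp_neg, inv_le_comm₀ (Real.exp_pos _) hpos]
  refine le_trans ?_ h
  rw [inv_le_iff_one_le_mul₀ hpos]
  nlinarith [sq_nonneg (u ^ 2)]

end ExponentialInequalities

/-! ### The empirical variance as an average over pairs -/

section PairAverage

/-- The variance kernel `(a - b)² / 2`. -/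
noncomputable def varKernel (a b : ℝ) : ℝ := (a - b) ^ 2 / 2

lemma varKernel_nonneg (a b : ℝ) : 0 ≤ varKernel a b := by
  unfold varKernel; positivity

lemma varKernel_le_half {a b : ℝ} (ha : a ∈ Set.Icc (0 : ℝ) 1) (hb : b ∈ Set.Icc (0 : ℝ) 1) :
    varKernel a b ≤ 1 / 2 := by
  obtain ⟨ha0, ha1⟩ := ha
  obtain ⟨hb0, hb1⟩ := hb
  have h : |a - b| ≤ 1 := abs_le.mpr ⟨by linarith, by linarith⟩
  have := (sq_le_one_iff_abs_le_one (a - b)).mpr h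
  unfold varKernel; linarith

/-- The diagonal contributes zero, and passing to ordered pairs counts each pair twice, which the
factor `1 / 2` in the kernel undoes. -/
lemma empVar_eq_sum_varKernel {m : ℕ} (v : Fin m → ℝ) :
    empVar v = (1 / ((m : ℝ) * ((m : ℝ) - 1))) *
      ∑ p : Fin m × Fin m with p.1 ≠ p.2, varKernel (v p.1) (v p.2) := by
  have hswap : ∑ p : Fin m × Fin m with p.2 ≤ p.1, (v p.1 - v p.2) ^ 2 =
      ∑ p : Fin m × Fin m with p.1 ≤ p.2, (v p.1 - v p.2) ^ 2 := by
    simp only [Finset.sum_filter]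
    refine Fintype.sum_equiv (Equiv.prodComm (Fin m) (Fin m)) _ _ fun p => ?_
    simp only [Equiv.prodComm_apply, Prod.fst_swap, Prod.snd_swap]
    rw [← neg_sub, neg_sq]
    congr
  have hsum : ∑ p : Fin m × Fin m with p.1 ≤ p.2, (v p.1 - v p.2) ^ 2 +
      ∑ p : Fin m × Fin m with p.2 ≤ p.1, (v p.1 - v p.2) ^ 2 =
      2 * ∑ p : Fin m × Fin m with p.1 ≠ p.2, varKernel (v p.1) (v p.2) := by
    simp only [Finset.sum_filter, ← Finset.sum_add_distrib, Finset.mul_sum]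
    refine Finset.sum_congr rfl fun p _ => ?_
    unfold varKernel
    rcases lt_trichotomy p.1 p.2 with h | h | h
    · simp [h.le, h.ne, not_le.mpr h]; ring
    · simp [h]
    · simp [h.le, h.ne', not_le.mpr h]; ring
  unfold empVar
  congr 1
  linarith

/-- The symmetric group is doubly transitive: reindex by right multiplication with a permutation
taking one pair to the other. -/
lemma sum_perm_apply_pair_congr {m : ℕ} (g : Fin m → Fin m → ℝ) {a b c d : Fin m} (hab : a ≠ b)
    (hcd : c ≠ d) :
    ∑ π : Equiv.Perm (Fin m), g (π a) (π b) = ∑ π : Equiv.Perm (Fin m), g (π c) (π d) := by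
  obtain ⟨τ, hτa, hτb⟩ := (MulAction.is_two_pretransitive_iff (G := Equiv.Perm (Fin m))).mp
    (Equiv.Perm.isMultiplyPretransitive (Fin m) 2) hab hcd
  refine (Fintype.sum_equiv (Equiv.mulRight τ) _ _ fun π => ?_).symm
  rw [← hτa, ← hτb]
  simp

/-- Double counting: sum over all pairs of distinct indices as well. For a fixed pair the sum over
permutations does not depend on the pair; for a fixed permutation the sum over pairs is merely
reindexed. -/
lemma sum_perm_apply_pair {m : ℕ} (g : Fin m → Fin m → ℝ) {a b : Fin m} (hab : a ≠ b) :
    (m : ℝ) * ((m : ℝ) - 1) * ∑ π : Equiv.Perm (Fin m), g (π a) (π b) =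
      (Fintype.card (Equiv.Perm (Fin m)) : ℝ) * ∑ p : Fin m × Fin m with p.1 ≠ p.2, g p.1 p.2 := by
  have hcard : ((Finset.univ.filter fun p : Fin m × Fin m => p.1 ≠ p.2).card : ℝ) =
      (m : ℝ) * ((m : ℝ) - 1) := by
    have h := Finset.offDiag_card (Finset.univ : Finset (Fin m))
    have h' : (Finset.univ.filter fun p : Fin m × Fin m => p.1 ≠ p.2) =
        (Finset.univ : Finset (Fin m)).offDiag := by ext; simp
    rw [h', h, Finset.card_univ, Fintype.card_fin, Nat.cast_sub (Nat.le_mul_self m)]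
    push_cast; ring
  have hconst : ∑ p : Fin m × Fin m with p.1 ≠ p.2, ∑ π : Equiv.Perm (Fin m), g (π p.1) (π p.2) =
      (m : ℝ) * ((m : ℝ) - 1) * ∑ π : Equiv.Perm (Fin m), g (π a) (π b) := by
    rw [Finset.sum_congr rfl fun p hp =>
      sum_perm_apply_pair_congr g (Finset.mem_filter.mp hp).2 hab, Finset.sum_const,
      nsmul_eq_mul, hcard]
  rw [← hconst, Finset.sum_comm]
  have hperm : ∀ π : Equiv.Perm (Fin m),
      ∑ p : Fin m × Fin m with p.1 ≠ p.2, g (π p.1) (π p.2) =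
        ∑ p : Fin m × Fin m with p.1 ≠ p.2, g p.1 p.2 := by
    intro π
    simp only [Finset.sum_filter]
    refine Fintype.sum_equiv (π.prodCongr π) _ _ fun p => ?_
    simp [π.injective.ne_iff]
  simp [hperm]

/-- Hoeffding's decomposition of the empirical variance: an average over all permutations of
averages over disjoint pairs of indices. -/
lemma empVar_eq_perm_average {m k : ℕ} (hm : 2 ≤ m) (hk : 0 < k) (e : Fin k × Fin 2 → Fin m)
    (he : e.Injective) (v : Fin m → ℝ) :
    (k : ℝ) * empVar v = ∑ π : Equiv.Perm (Fin m), (Fintype.card (Equiv.Perm (Fin m)) : ℝ)⁻¹ *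
      ∑ j : Fin k, varKernel (v (π (e (j, 0)))) (v (π (e (j, 1)))) := by
  have hN : (Fintype.card (Equiv.Perm (Fin m)) : ℝ) ≠ 0 := by
    exact_mod_cast Fintype.card_ne_zero
  have hm' : (2 : ℝ) ≤ m := by exact_mod_cast hm
  have hm0 : (m : ℝ) * ((m : ℝ) - 1) ≠ 0 := by
    have h1 : (m : ℝ) - 1 ≠ 0 := by linarith
    have h2 : (m : ℝ) ≠ 0 := by linarith
    exact mul_ne_zero h2 h1
  have hj : ∀ j : Fin k, ∑ π : Equiv.Perm (Fin m),
      varKernel (v (π (e (j, 0)))) (v (π (e (j, 1)))) =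
        (Fintype.card (Equiv.Perm (Fin m)) : ℝ) * empVar v := by
    intro j
    have h := sum_perm_apply_pair (fun a b => varKernel (v a) (v b))
      (a := e (j, 0)) (b := e (j, 1)) (fun h => by simpa using he h)
    rw [empVar_eq_sum_varKernel, mul_left_comm, ← h, one_div, inv_mul_cancel_left₀ hm0]
  rw [← Finset.mul_sum, Finset.sum_comm, Finset.sum_congr rfl fun j _ => hj j]
  simp
  field_simp

lemma empVar_nonneg {m : ℕ} (v : Fin m → ℝ) : 0 ≤ empVar v := by
  unfold empVar
  rcases Nat.eq_zero_or_pos m with rfl | hm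
  · simp
  · have : (1 : ℝ) ≤ m := by exact_mod_cast hm
    have : (0 : ℝ) ≤ (m : ℝ) - 1 := by linarith
    positivity

end PairAverage

/-! ### Independence across disjoint pairs -/

section Independence

variable {Ω : Type*} [MeasurableSpace Ω] {P : Measure Ω}

/-- Functions of disjoint pairs of independent random variables are uncorrelated. -/
lemma integral_prod_pairs [IsProbabilityMeasure P] {ι κ : Type*} {X : ι → Ω → ℝ}
    (hX : ∀ i, Measurable (X i)) (hind : iIndepFun X P) {g : ℝ → ℝ → ℝ}
    (hg : Measurable (Function.uncurry g)) (e : κ × Fin 2 → ι) (he : e.Injective)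
    (J : Finset κ) :
    ∫ ω, ∏ j ∈ J, g (X (e (j, 0)) ω) (X (e (j, 1)) ω) ∂P =
      ∏ j ∈ J, ∫ ω, g (X (e (j, 0)) ω) (X (e (j, 1)) ω) ∂P := by
  classical
  induction J using Finset.induction_on with
  | empty => simp
  | insert a J ha ih =>
    set S : Finset ι := {e (a, 0), e (a, 1)} with hS
    set T : Finset ι := (J ×ˢ (Finset.univ : Finset (Fin 2))).image e with hT
    have hmemS : ∀ s : Fin 2, e (a, s) ∈ S := by
      intro s; fin_cases s <;> simp [hS]
    have hmemT : ∀ j ∈ J, ∀ s : Fin 2, e (j, s) ∈ T := by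
      intro j hj s
      exact Finset.mem_image_of_mem e (by simp [hj])
    have hdisj : Disjoint S T := by
      rw [Finset.disjoint_left]
      intro i hi hi'
      obtain ⟨⟨j, s⟩, hj, rfl⟩ := Finset.mem_image.mp hi'
      have hja : j = a := by
        rcases Finset.mem_insert.mp hi with h | h
        · exact congrArg Prod.fst (he h)
        · exact congrArg Prod.fst (he (Finset.mem_singleton.mp h))
      simp only [Finset.mem_product, Finset.mem_univ, and_true] at hj
      exact ha (hja ▸ hj)
    -- Injectivity of `e` makes the indices of the new pair disjoint from all earlier ones, so the
    -- new factor is independent of the remaining product.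
    have hindep := hind.indepFun_finset S T hdisj hX
    have hg' : ∀ {V : Finset ι} (i j : V), Measurable fun z : V → ℝ => g (z i) (z j) :=
      fun i j => hg.comp
        ((measurable_pi_apply (X := fun _ => ℝ) i).prodMk (measurable_pi_apply j))
    have hφ : Measurable (fun z : S → ℝ => g (z ⟨_, hmemS 0⟩) (z ⟨_, hmemS 1⟩)) := hg' _ _
    have hψ : Measurable (fun z : T → ℝ => ∏ j ∈ J.attach,
        g (z ⟨_, hmemT j.1 j.2 0⟩) (z ⟨_, hmemT j.1 j.2 1⟩)) :=
      Finset.measurable_fun_prod _ fun j _ => hg' _ _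
    have hmul := hindep.integral_fun_comp_mul_comp
      (measurable_pi_lambda _ fun i : S => hX i).aemeasurable
      (measurable_pi_lambda _ fun i : T => hX i).aemeasurable
      hφ.aestronglyMeasurable hψ.aestronglyMeasurable
    have hatt : ∀ ω, ∏ j ∈ J.attach, g (X (e (j.1, 0)) ω) (X (e (j.1, 1)) ω) =
        ∏ j ∈ J, g (X (e (j, 0)) ω) (X (e (j, 1)) ω) := fun ω =>
      Finset.prod_attach J fun j => g (X (e (j, 0)) ω) (X (e (j, 1)) ω)
    simp only [hatt] at hmul
    simp only [Finset.prod_insert ha]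
    rw [hmul, ih]

end Independence

/-! ### The empirical Bernstein inequality -/

section EmpiricalBernstein

variable {Ω : Type*} [MeasurableSpace Ω] {P : Measure Ω} [IsProbabilityMeasure P]

lemma integrable_of_mem_Icc {Y : Ω → ℝ} {a b : ℝ} (hY : Measurable Y)
    (hb : ∀ ω, Y ω ∈ Set.Icc a b) : Integrable Y P :=
  Integrable.of_mem_Icc a b hY.aemeasurable (ae_of_all _ hb)

lemma integral_quadratic {Y : Ω → ℝ} (hY : Integrable Y P)
    (hY2 : Integrable (fun ω => Y ω ^ 2) P) (a b c : ℝ) :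
    ∫ ω, (a + b * Y ω + c * Y ω ^ 2) ∂P = a + b * ∫ ω, Y ω ∂P + c * ∫ ω, Y ω ^ 2 ∂P := by
  have h1 : Integrable (fun ω => a + b * Y ω) P := (integrable_const _).add (hY.const_mul _)
  rw [integral_add h1 (hY2.const_mul _), integral_add (integrable_const _) (hY.const_mul _),
    integral_const_mul, integral_const_mul]
  simp

/-- As `|t (μ - Y)| ≤ t < 3`, the exponential is dominated by a quadratic polynomial in `Y` with
deterministic coefficients, so only the first two moments enter. -/
lemma integral_exp_sub_le {Y : Ω → ℝ} (hY : Measurable Y)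
    (hb : ∀ ω, Y ω ∈ Set.Icc (0 : ℝ) 1) {μ v : ℝ} (hμ : ∫ ω, Y ω ∂P = μ)
    (hv : ∫ ω, Y ω ^ 2 ∂P = μ ^ 2 + v) {t : ℝ} (ht : 0 ≤ t) (ht3 : t < 3) :
    ∫ ω, Real.exp (t * (μ - Y ω)) ∂P ≤ Real.exp (v * t ^ 2 / (2 * (1 - t / 3))) := by
  have hiY : Integrable Y P := integrable_of_mem_Icc hY hb
  have hiY2 : Integrable (fun ω => Y ω ^ 2) P :=
    integrable_of_mem_Icc (a := 0) (b := 1) (hY.pow_const 2) fun ω =>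
      ⟨by positivity, pow_le_one₀ (hb ω).1 (hb ω).2⟩
  have hμ0 : 0 ≤ μ := hμ ▸ integral_nonneg fun ω => (hb ω).1
  have hμ1 : μ ≤ 1 := by
    rw [← hμ]
    calc ∫ ω, Y ω ∂P ≤ ∫ _, (1 : ℝ) ∂P :=
          integral_mono hiY (integrable_const _) fun ω => (hb ω).2
      _ = 1 := by simp
  set C : ℝ := t ^ 2 / (2 * (1 - t / 3)) with hC
  have hpt : ∀ ω, Real.exp (t * (μ - Y ω)) ≤
      (1 + t * μ + C * μ ^ 2) + (-(t + 2 * C * μ)) * Y ω + C * Y ω ^ 2 := by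
    intro ω
    have habs : |t * (μ - Y ω)| ≤ t := by
      rw [abs_mul, abs_of_nonneg ht]
      refine mul_le_of_le_one_right ht (abs_le.mpr ⟨?_, ?_⟩) <;>
        linarith [(hb ω).1, (hb ω).2]
    have h1 := exp_le_of_abs_lt_three (habs.trans_lt ht3)
    have h2 : (t * (μ - Y ω)) ^ 2 / (2 * (1 - |t * (μ - Y ω)| / 3)) ≤
        (t * (μ - Y ω)) ^ 2 / (2 * (1 - t / 3)) := by
      have : 0 < 1 - t / 3 := by linarith
      gcongr
    have h3 : (t * (μ - Y ω)) ^ 2 / (2 * (1 - t / 3)) = C * (μ - Y ω) ^ 2 := by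
      rw [hC]; ring
    nlinarith
  have hint : Integrable (fun ω => Real.exp (t * (μ - Y ω))) P := by
    refine integrable_of_mem_Icc (a := 0) (b := Real.exp t) (by fun_prop) fun ω =>
      ⟨(Real.exp_pos _).le, Real.exp_le_exp.mpr ?_⟩
    exact mul_le_of_le_one_right ht (by linarith [(hb ω).1])
  calc ∫ ω, Real.exp (t * (μ - Y ω)) ∂P
      ≤ ∫ ω, (1 + t * μ + C * μ ^ 2) + (-(t + 2 * C * μ)) * Y ω + C * Y ω ^ 2 ∂P :=
        integral_mono hint (((integrable_const _).add (hiY.const_mul _)).add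
          (hiY2.const_mul _)) hpt
    _ = 1 + C * v := by
        rw [integral_quadratic hiY hiY2, hμ, hv]
        ring
    _ ≤ Real.exp (C * v) := by linarith [Real.add_one_le_exp (C * v)]
    _ = Real.exp (v * t ^ 2 / (2 * (1 - t / 3))) := by rw [hC]; ring_nf

variable {m : ℕ} {X : Fin m → Ω → ℝ}

/-- Bernstein's inequality for the lower tail of the mean of variables with values in `[0, 1]`. -/
theorem measure_mean_le_le (hm : 0 < m) (hX : ∀ i, Measurable (X i)) (hind : iIndepFun X P)
    (hb : ∀ i ω, X i ω ∈ Set.Icc (0 : ℝ) 1) {μ v L : ℝ} (hμ : ∀ i, ∫ ω, X i ω ∂P = μ)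
    (hv : ∀ i, ∫ ω, X i ω ^ 2 ∂P = μ ^ 2 + v) (hv0 : 0 < v) (hL : 0 < L) :
    P.real {ω | vecMean (fun i => X i ω) + √(2 * v * L / m) + L / (3 * m) ≤ μ} ≤
      Real.exp (-L) := by
  have hm' : (0 : ℝ) < m := by exact_mod_cast hm
  set r : ℝ := √(2 * L / (m * v)) with hr
  have hr0 : 0 < r := Real.sqrt_pos.mpr (by positivity)
  have hr2 : r ^ 2 * (m * v) = 2 * L := by
    rw [hr, Real.sq_sqrt (by positivity)]; field_simp
  have hsqrt : √(2 * v * L / m) = r * v := by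
    have h : 2 * v * L / m = (r * v) ^ 2 := by
      field_simp
      linear_combination -hr2
    rw [h, Real.sqrt_sq (by positivity)]
  -- With this `t`, `1 - t / 3 = 1 / (1 + r / 3)`, and the Chernoff exponent is exactly `-L`.
  set t : ℝ := r / (1 + r / 3) with ht
  have ht0 : 0 < t := by positivity
  have ht3 : t < 3 := by
    rw [ht, div_lt_iff₀ (by positivity)]; linarith
  have ht' : 1 - t / 3 = 1 / (1 + r / 3) := by
    rw [ht]; field_simp; ring
  have hindY : iIndepFun (fun i ω => μ - X i ω) P :=
    hind.comp (fun _ z => μ - z) fun _ => by fun_prop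
  have hmgf : mgf (∑ i, fun ω => μ - X i ω) P t ≤
      Real.exp (v * t ^ 2 / (2 * (1 - t / 3))) ^ m := by
    rw [hindY.mgf_sum (fun i => by fun_prop)]
    calc ∏ i, mgf (fun ω => μ - X i ω) P t
        ≤ ∏ _i : Fin m, Real.exp (v * t ^ 2 / (2 * (1 - t / 3))) :=
          Finset.prod_le_prod (fun i _ => mgf_nonneg) fun i _ =>
            integral_exp_sub_le (hX i) (hb i) (hμ i) (hv i) ht0.le ht3
      _ = _ := by simp
  have hsum : ∀ ω, (∑ i, fun ω => μ - X i ω : Ω → ℝ) ω =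
      m * (μ - vecMean fun i => X i ω) := by
    intro ω
    simp only [Finset.sum_apply, Finset.sum_sub_distrib, Finset.sum_const, Finset.card_univ,
      Fintype.card_fin, nsmul_eq_mul, vecMean]
    field_simp
  have hint : Integrable (fun ω => Real.exp (t * (∑ i, fun ω => μ - X i ω : Ω → ℝ) ω)) P := by
    refine integrable_of_mem_Icc (a := 0) (b := Real.exp (t * (m * |μ|))) ?_ fun ω =>
      ⟨(Real.exp_pos _).le, Real.exp_le_exp.mpr ?_⟩
    · have : Measurable (∑ i, fun ω => μ - X i ω : Ω → ℝ) :=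
        Finset.sum_induction _ _ (fun _ _ => Measurable.add) measurable_const
          fun i _ => (hX i).const_sub μ
      fun_prop
    · rw [hsum]
      have : 0 ≤ vecMean fun i => X i ω := by
        unfold vecMean
        exact mul_nonneg (by positivity) (Finset.sum_nonneg fun i _ => (hb i ω).1)
      gcongr
      linarith [le_abs_self μ]
  have hchern := measure_ge_le_exp_mul_mgf (m * (√(2 * v * L / m) + L / (3 * m))) ht0.le hint
  have hset : {ω | vecMean (fun i => X i ω) + √(2 * v * L / m) + L / (3 * m) ≤ μ} =
      {ω | m * (√(2 * v * L / m) + L / (3 * m)) ≤ (∑ i, fun ω => μ - X i ω : Ω → ℝ) ω} := by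
    ext ω
    simp only [Set.mem_ofPred_eq, hsum]
    rw [mul_le_mul_iff_right₀ hm']
    constructor <;> intro h <;> linarith
  rw [hset]
  refine hchern.trans ((mul_le_mul_of_nonneg_left hmgf (Real.exp_pos _).le).trans ?_)
  rw [← Real.exp_nat_mul, ← Real.exp_add, Real.exp_le_exp, hsqrt, ht']
  have hkey : -t * (m * (r * v + L / (3 * m))) + m * (v * t ^ 2 / (2 * (1 / (1 + r / 3)))) = -L := by
    have hL' : L = r ^ 2 * (m * v) / 2 := by linarith
    rw [hL', ht]
    field_simp
    ring
  exact hkey.le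

/-- The kernel `q` has mean `v` and values in `[0, 1/2]`, so `q² ≤ q / 2` and `exp (-t q) ≤ 1 - t q
+ t² q / 4`, which is affine in `q`. -/
lemma integral_exp_neg_varKernel_le {Y Y' : Ω → ℝ} (hY : Measurable Y) (hY' : Measurable Y')
    (hind : IndepFun Y Y' P) (hb : ∀ ω, Y ω ∈ Set.Icc (0 : ℝ) 1)
    (hb' : ∀ ω, Y' ω ∈ Set.Icc (0 : ℝ) 1) {μ v : ℝ} (hμ : ∫ ω, Y ω ∂P = μ)
    (hμ' : ∫ ω, Y' ω ∂P = μ) (hv : ∫ ω, Y ω ^ 2 ∂P = μ ^ 2 + v)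
    (hv' : ∫ ω, Y' ω ^ 2 ∂P = μ ^ 2 + v) {t : ℝ} (ht : 0 ≤ t) :
    ∫ ω, Real.exp (-(t * varKernel (Y ω) (Y' ω))) ∂P ≤ Real.exp (-(t * v) + t ^ 2 * v / 4) := by
  have hmeas : Measurable fun ω => varKernel (Y ω) (Y' ω) := by
    unfold varKernel; fun_prop
  have hiq : Integrable (fun ω => varKernel (Y ω) (Y' ω)) P :=
    integrable_of_mem_Icc hmeas fun ω =>
      ⟨varKernel_nonneg _ _, varKernel_le_half (hb ω) (hb' ω)⟩
  have hiY2 : Integrable (fun ω => Y ω ^ 2) P :=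
    integrable_of_mem_Icc (a := 0) (b := 1) (hY.pow_const 2) fun ω =>
      ⟨by positivity, pow_le_one₀ (hb ω).1 (hb ω).2⟩
  have hiY2' : Integrable (fun ω => Y' ω ^ 2) P :=
    integrable_of_mem_Icc (a := 0) (b := 1) (hY'.pow_const 2) fun ω =>
      ⟨by positivity, pow_le_one₀ (hb' ω).1 (hb' ω).2⟩
  have hiYY' : Integrable (fun ω => Y ω * Y' ω) P :=
    integrable_of_mem_Icc (a := 0) (b := 1) (hY.mul hY') fun ω =>
      ⟨mul_nonneg (hb ω).1 (hb' ω).1, mul_le_one₀ (hb ω).2 (hb' ω).1 (hb' ω).2⟩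
  have hq : ∫ ω, varKernel (Y ω) (Y' ω) ∂P = v := by
    have hexp : ∀ ω, varKernel (Y ω) (Y' ω) =
        1 / 2 * Y ω ^ 2 + 1 / 2 * Y' ω ^ 2 - Y ω * Y' ω := fun ω => by
      unfold varKernel; ring
    simp only [hexp]
    have hiadd : Integrable (fun ω => 1 / 2 * Y ω ^ 2 + 1 / 2 * Y' ω ^ 2) P :=
      (hiY2.const_mul _).add (hiY2'.const_mul _)
    rw [integral_sub hiadd hiYY',
      integral_add (hiY2.const_mul _) (hiY2'.const_mul _), integral_const_mul,
      integral_const_mul, hv, hv',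
      hind.integral_fun_mul_eq_mul_integral hY.aestronglyMeasurable hY'.aestronglyMeasurable,
      hμ, hμ']
    ring
  have hpt : ∀ ω, Real.exp (-(t * varKernel (Y ω) (Y' ω))) ≤
      1 + (-t + t ^ 2 / 4) * varKernel (Y ω) (Y' ω) := by
    intro ω
    have h0 := varKernel_nonneg (Y ω) (Y' ω)
    have h1 := varKernel_le_half (hb ω) (hb' ω)
    have h2 := exp_neg_le_quadratic (mul_nonneg ht h0)
    have h3 : t ^ 2 * (varKernel (Y ω) (Y' ω) * varKernel (Y ω) (Y' ω)) ≤
        t ^ 2 * (varKernel (Y ω) (Y' ω) * (1 / 2)) := by gcongr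
    nlinarith
  have hint : Integrable (fun ω => Real.exp (-(t * varKernel (Y ω) (Y' ω)))) P :=
    integrable_of_mem_Icc (a := 0) (b := 1) (by fun_prop) fun ω =>
      ⟨(Real.exp_pos _).le, Real.exp_le_one_iff.mpr
        (neg_nonpos.mpr (mul_nonneg ht (varKernel_nonneg _ _)))⟩
  calc ∫ ω, Real.exp (-(t * varKernel (Y ω) (Y' ω))) ∂P
      ≤ ∫ ω, 1 + (-t + t ^ 2 / 4) * varKernel (Y ω) (Y' ω) ∂P :=
        integral_mono hint ((integrable_const _).add (hiq.const_mul _)) hpt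
    _ = -(t * v) + t ^ 2 * v / 4 + 1 := by
        rw [integral_add (integrable_const _) (hiq.const_mul _), integral_const_mul, hq]
        simp
        ring
    _ ≤ _ := Real.add_one_le_exp _

/-- Lower tail of the empirical variance of variables with values in `[0, 1]`. -/
theorem measure_empVar_le_le (hm : 2 ≤ m) (hX : ∀ i, Measurable (X i)) (hind : iIndepFun X P)
    (hb : ∀ i ω, X i ω ∈ Set.Icc (0 : ℝ) 1) {μ v L : ℝ} (hμ : ∀ i, ∫ ω, X i ω ∂P = μ)
    (hv : ∀ i, ∫ ω, X i ω ^ 2 ∂P = μ ^ 2 + v) (hv0 : 0 < v) (hL : 0 < L) :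
    P.real {ω | empVar (fun i => X i ω) ≤ v - √v * √(2 * L / ((m : ℝ) - 1))} ≤
      Real.exp (-L) := by
  -- `k = ⌊m / 2⌋` disjoint pairs fit into `m` indices. The bound `m - 1 ≤ 2 k`, valid for either
  -- parity, is what puts `m - 1` into the deviation.
  obtain ⟨k, hk, hkm, hmk⟩ : ∃ k : ℕ, 0 < k ∧ k * 2 ≤ m ∧ m ≤ k * 2 + 1 :=
    ⟨m / 2, by omega, by omega, by omega⟩
  have hk' : (0 : ℝ) < k := by exact_mod_cast hk
  have hmk' : (m : ℝ) ≤ k * 2 + 1 := by exact_mod_cast hmk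
  have hm1 : (0 : ℝ) < (m : ℝ) - 1 := by
    have : (2 : ℝ) ≤ m := by exact_mod_cast hm
    linarith
  set e : Fin k × Fin 2 → Fin m := fun p => Fin.castLE hkm (finProdFinEquiv p) with he
  have hinj : e.Injective := (Fin.castLE_injective hkm).comp finProdFinEquiv.injective
  set s : ℝ := √v * √(2 * L / ((m : ℝ) - 1)) with hs
  have hs2 : s ^ 2 = v * (2 * L / ((m : ℝ) - 1)) := by
    rw [hs, mul_pow, Real.sq_sqrt hv0.le, Real.sq_sqrt (by positivity)]
  have hs0 : 0 ≤ s := by positivity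
  -- Minimizer of the exponent `k (-t s + t² v / 4)`, with minimum `-k s² / v`.
  set t : ℝ := 2 * s / v with ht
  have ht0 : 0 ≤ t := by positivity
  have hXv : Measurable fun ω => empVar fun i => X i ω := by
    unfold empVar
    exact (Finset.measurable_fun_sum _ fun p _ => by fun_prop).const_mul _
  have hprod : ∀ π : Equiv.Perm (Fin m), ∫ ω, ∏ j : Fin k,
      Real.exp (-(t * varKernel (X (π (e (j, 0))) ω) (X (π (e (j, 1))) ω))) ∂P ≤
        Real.exp (-(t * v) + t ^ 2 * v / 4) ^ k := by
    intro π
    rw [integral_prod_pairs hX hind (g := fun a b => Real.exp (-(t * varKernel a b)))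
      (by unfold varKernel Function.uncurry; fun_prop) (fun p => π (e p))
      (π.injective.comp hinj)]
    calc _ ≤ ∏ _j : Fin k, Real.exp (-(t * v) + t ^ 2 * v / 4) := by
          refine Finset.prod_le_prod (fun j _ => integral_nonneg fun ω => (Real.exp_pos _).le)
            fun j _ => ?_
          refine integral_exp_neg_varKernel_le (hX _) (hX _) (hind.indepFun ?_) (hb _) (hb _)
            (hμ _) (hμ _) (hv _) (hv _) ht0
          exact fun h => by simpa using hinj (π.injective h)
      _ = _ := by simp
  have hint : ∀ π : Equiv.Perm (Fin m), Integrable (fun ω => ∏ j : Fin k,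
      Real.exp (-(t * varKernel (X (π (e (j, 0))) ω) (X (π (e (j, 1))) ω)))) P := by
    intro π
    refine integrable_of_mem_Icc (a := 0) (b := 1)
      (Finset.measurable_fun_prod _ fun j _ => by unfold varKernel; fun_prop) fun ω =>
      ⟨Finset.prod_nonneg fun j _ => (Real.exp_pos _).le,
        Finset.prod_le_one (fun j _ => (Real.exp_pos _).le) fun j _ =>
          Real.exp_le_one_iff.mpr (neg_nonpos.mpr (mul_nonneg ht0 (varKernel_nonneg _ _)))⟩
  have hN : (Fintype.card (Equiv.Perm (Fin m)) : ℝ) ≠ 0 := by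
    exact_mod_cast Fintype.card_ne_zero
  -- Convexity of `exp`, applied to the permutation average; within each permutation the `k` pairs
  -- are disjoint, so the expectation of the product factorizes.
  have hjensen : ∀ ω, Real.exp (-(t * k) * empVar fun i => X i ω) ≤
      ∑ π : Equiv.Perm (Fin m), (Fintype.card (Equiv.Perm (Fin m)) : ℝ)⁻¹ * ∏ j : Fin k,
        Real.exp (-(t * varKernel (X (π (e (j, 0))) ω) (X (π (e (j, 1))) ω))) := by
    intro ω
    have hw : ∑ _π : Equiv.Perm (Fin m), (Fintype.card (Equiv.Perm (Fin m)) : ℝ)⁻¹ = 1 := by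
      rw [Finset.sum_const, Finset.card_univ, nsmul_eq_mul, mul_inv_cancel₀ hN]
    have h := convexOn_exp.map_sum_le (t := (Finset.univ : Finset (Equiv.Perm (Fin m))))
      (w := fun _ => (Fintype.card (Equiv.Perm (Fin m)) : ℝ)⁻¹)
      (p := fun π => ∑ j : Fin k,
        -(t * varKernel (X (π (e (j, 0))) ω) (X (π (e (j, 1))) ω)))
      (fun _ _ => by positivity) hw (fun _ _ => Set.mem_univ _)
    simp only [smul_eq_mul] at h
    simp only [← Real.exp_sum]
    refine (Real.exp_le_exp.mpr (le_of_eq ?_)).trans h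
    rw [neg_mul, mul_assoc, empVar_eq_perm_average hm hk e hinj, Finset.mul_sum,
      ← Finset.sum_neg_distrib]
    refine Finset.sum_congr rfl fun π _ => ?_
    rw [Finset.sum_neg_distrib, ← Finset.mul_sum]
    ring
  have hint' : Integrable (fun ω => Real.exp (-(t * k) * empVar fun i => X i ω)) P :=
    integrable_of_mem_Icc (a := 0) (b := 1) (by fun_prop) fun ω =>
      ⟨(Real.exp_pos _).le, Real.exp_le_one_iff.mpr
        (mul_nonpos_of_nonpos_of_nonneg (by simp; positivity) (empVar_nonneg _))⟩
  have hmgf : mgf (fun ω => empVar fun i => X i ω) P (-(t * k)) ≤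
      Real.exp (-(t * v) + t ^ 2 * v / 4) ^ k := by
    calc ∫ ω, Real.exp (-(t * k) * empVar fun i => X i ω) ∂P
        ≤ ∫ ω, ∑ π : Equiv.Perm (Fin m), (Fintype.card (Equiv.Perm (Fin m)) : ℝ)⁻¹ *
            ∏ j : Fin k,
              Real.exp (-(t * varKernel (X (π (e (j, 0))) ω) (X (π (e (j, 1))) ω))) ∂P :=
          integral_mono hint' (integrable_finsetSum _ fun π _ => (hint π).const_mul _) hjensen
      _ = ∑ π : Equiv.Perm (Fin m), (Fintype.card (Equiv.Perm (Fin m)) : ℝ)⁻¹ *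
            ∫ ω, ∏ j : Fin k,
              Real.exp (-(t * varKernel (X (π (e (j, 0))) ω) (X (π (e (j, 1))) ω))) ∂P := by
          rw [integral_finsetSum _ fun π _ => (hint π).const_mul _]
          simp only [integral_const_mul]
      _ ≤ ∑ π : Equiv.Perm (Fin m), (Fintype.card (Equiv.Perm (Fin m)) : ℝ)⁻¹ *
            Real.exp (-(t * v) + t ^ 2 * v / 4) ^ k := by
          gcongr with π
          exact hprod π
      _ = _ := by
          rw [Finset.sum_const, Finset.card_univ, nsmul_eq_mul, ← mul_assoc,
            mul_inv_cancel₀ hN, one_mul]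
  have hchern := measure_le_le_exp_mul_mgf (μ := P) (X := fun ω => empVar fun i => X i ω)
    (t := -(t * k)) (v - s) (by simp; positivity) hint'
  refine hchern.trans ((mul_le_mul_of_nonneg_left hmgf (Real.exp_pos _).le).trans ?_)
  rw [← Real.exp_nat_mul, ← Real.exp_add, Real.exp_le_exp]
  have hkey : -(-(t * k)) * (v - s) + k * (-(t * v) + t ^ 2 * v / 4) = -(k * s ^ 2 / v) := by
    rw [ht]; field_simp; ring
  rw [hkey, hs2, neg_le_neg_iff]
  have : k * (v * (2 * L / ((m : ℝ) - 1))) / v = L * (k * 2) / ((m : ℝ) - 1) := by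
    field_simp
  rw [this, le_div_iff₀ hm1]
  gcongr
  linarith

/-- Otherwise `√v - c > √V`, and multiplying by `√v > √V` gives `v - √v * c > V`. -/
lemma sqrt_le_sqrt_add_of_sub_le {v V c : ℝ} (hc : 0 ≤ c) (hv : 0 ≤ v) (hV : 0 ≤ V)
    (h : v - √v * c ≤ V) : √v ≤ √V + c := by
  by_contra! hlt
  have h1 := Real.sq_sqrt hv
  have h2 := Real.sq_sqrt hV
  have h3 := Real.sqrt_nonneg V
  have h4 := Real.sqrt_nonneg v
  nlinarith [mul_lt_mul_of_pos_left hlt (show 0 < √v by linarith)]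

/-- The empirical Bernstein inequality of Maurer and Pontil for variables with values
in `[0, 1]`. -/
theorem measure_mean_add_psi_lt_le_of_mem_Icc (hm : 2 ≤ m) (hX : ∀ i, Measurable (X i))
    (hind : iIndepFun X P) (hb : ∀ i ω, X i ω ∈ Set.Icc (0 : ℝ) 1) {μ s α : ℝ}
    (hμ : ∀ i, ∫ ω, X i ω ∂P = μ) (hs : ∀ i, ∫ ω, X i ω ^ 2 ∂P = s)
    (hα : 0 < α) (hα' : α < 2) :
    P.real {ω | vecMean (fun i => X i ω) + psi 1 α m (empVar fun i => X i ω) < μ} ≤ α := by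
  set L : ℝ := Real.log (2 / α) with hLdef
  have hL : 0 < L := Real.log_pos (by rw [lt_div_iff₀ hα]; linarith)
  have hexpL : Real.exp (-L) = α / 2 := by
    rw [Real.exp_neg, hLdef, Real.exp_log (by positivity), inv_div]
  have hm2 : (2 : ℝ) ≤ m := by exact_mod_cast hm
  have hm0 : (0 : ℝ) < m := by linarith
  have hm1 : (0 : ℝ) < (m : ℝ) - 1 := by linarith
  have hiX : ∀ i, Integrable (X i) P := fun i => integrable_of_mem_Icc (hX i) (hb i)
  have hiX2 : ∀ i, Integrable (fun ω => X i ω ^ 2) P := fun i =>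
    integrable_of_mem_Icc (a := 0) (b := 1) ((hX i).pow_const 2) fun ω =>
      ⟨by positivity, pow_le_one₀ (hb i ω).1 (hb i ω).2⟩
  obtain ⟨v, rfl⟩ : ∃ v, s = μ ^ 2 + v := ⟨s - μ ^ 2, by ring⟩
  have hvar : ∀ i, ∫ ω, (X i ω - μ) ^ 2 ∂P = v := by
    intro i
    have hexp : ∀ ω, (X i ω - μ) ^ 2 = μ ^ 2 + (-(2 * μ)) * X i ω + 1 * X i ω ^ 2 :=
      fun ω => by ring
    simp only [hexp]
    rw [integral_quadratic (hiX i) (hiX2 i), hμ, hs]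
    ring
  have hi0 : Fin m := ⟨0, by omega⟩
  have hv0 : 0 ≤ v := hvar hi0 ▸ integral_nonneg fun ω => sq_nonneg _
  have hpsi : ∀ w, 0 ≤ psi 1 α m w := fun w => by
    unfold psi
    rw [← hLdef]
    positivity
  -- The two tail bounds need `v > 0`. If `v = 0`, the variables are almost surely equal to `μ` and
  -- the event is null.
  rcases hv0.eq_or_lt with hv | hv
  · have hae : ∀ i, ∀ᵐ ω ∂P, X i ω = μ := by
      intro i
      have h := hvar i
      rw [← hv, integral_eq_zero_iff_of_nonneg (fun ω => sq_nonneg _)] at h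
      · filter_upwards [h] with ω hω
        have : (X i ω - μ) ^ 2 = 0 := hω
        linarith [pow_eq_zero_iff (two_ne_zero) |>.mp this]
      · refine integrable_of_mem_Icc (a := 0) (b := (1 + |μ|) ^ 2) (((hX i).sub_const μ).pow_const 2) fun ω =>
          ⟨sq_nonneg _, ?_⟩
        refine sq_le_sq' ?_ ?_ <;>
          linarith [(hb i ω).1, (hb i ω).2, le_abs_self μ, neg_abs_le μ]
    have hzero : P.real {ω | vecMean (fun i => X i ω) +
        psi 1 α m (empVar fun i => X i ω) < μ} = 0 := by
      rw [measureReal_eq_zero_iff]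
      refine measure_mono_null (t := {ω | ¬ ∀ i, X i ω = μ}) ?_ (ae_all_iff.mpr hae)
      intro ω hω hall
      have hmean : vecMean (fun i => X i ω) = μ := by
        simp only [hall, vecMean, Finset.sum_const, Finset.card_univ, Fintype.card_fin,
          nsmul_eq_mul]
        field_simp
      have := hpsi (empVar fun i => X i ω)
      simp only [Set.mem_ofPred_eq, hmean] at hω
      linarith
    rw [hzero]
    exact hα.le
  · have h1 := measure_mean_le_le (by omega) hX hind hb hμ hs hv hL
    have h2 := measure_empVar_le_le hm hX hind hb hμ hs hv hL
    rw [hexpL] at h1 h2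
    refine (measureReal_mono ?_).trans ((measureReal_union_le
      {ω | vecMean (fun i => X i ω) + √(2 * v * L / m) + L / (3 * m) ≤ μ}
      {ω | empVar (fun i => X i ω) ≤ v - √v * √(2 * L / ((m : ℝ) - 1))}).trans
      (by linarith))
    intro ω hω
    by_contra hnot
    simp only [Set.mem_union, Set.mem_ofPred_eq, not_or, not_le] at hnot hω
    obtain ⟨hmean, hvarlt⟩ := hnot
    set V : ℝ := empVar fun i => X i ω with hV
    have hV0 : 0 ≤ V := empVar_nonneg _
    have hsq := sqrt_le_sqrt_add_of_sub_le (Real.sqrt_nonneg _) hv.le hV0 hvarlt.le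
    have ha : √(2 * v * L / m) = √v * √(2 * L / m) := by
      rw [← Real.sqrt_mul hv.le]; congr 1; ring
    have hbV : √(2 * V * L / m) = √V * √(2 * L / m) := by
      rw [← Real.sqrt_mul hV0]; congr 1; ring
    have hle1 : √(2 * L / m) ≤ √(2 * L / ((m : ℝ) - 1)) := by
      apply Real.sqrt_le_sqrt
      gcongr
      linarith
    have hle2 : √(2 * L / ((m : ℝ) - 1)) * √(2 * L / m) ≤ 2 * L / ((m : ℝ) - 1) := by
      calc _ ≤ √(2 * L / ((m : ℝ) - 1)) * √(2 * L / ((m : ℝ) - 1)) := by gcongr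
        _ = _ := Real.mul_self_sqrt (by positivity)
    have hle3 : L / (3 * m) ≤ L / (3 * ((m : ℝ) - 1)) := by
      gcongr
      linarith
    -- Origin of the constant `7 / 3`: `2` comes from replacing `√v` by `√V`, and `1 / 3` from
    -- Bernstein's linear term.
    have hsum : 2 * L / ((m : ℝ) - 1) + L / (3 * ((m : ℝ) - 1)) =
        1 * (7 * L / (3 * ((m : ℝ) - 1))) := by
      field_simp; ring
    have hmul := mul_le_mul_of_nonneg_right hsq (Real.sqrt_nonneg (2 * L / m))
    unfold psi at hω
    rw [← hLdef, hbV] at hω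
    rw [ha] at hmean
    linarith

lemma vecMean_smul (c : ℝ) (w : Fin m → ℝ) : vecMean (fun i => c * w i) = c * vecMean w := by
  unfold vecMean
  rw [← Finset.mul_sum]
  ring

lemma empVar_smul (c : ℝ) (w : Fin m → ℝ) : empVar (fun i => c * w i) = c ^ 2 * empVar w := by
  unfold empVar
  rw [mul_left_comm, Finset.mul_sum (a := c ^ 2)]
  congr 1
  exact Finset.sum_congr rfl fun p _ => by ring

/-- Scaling data by `κ` multiplies the variance by `κ²` and hence `psi` by `κ`; this reduces the
range `[0, κ]` to `[0, 1]`. -/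
lemma psi_smul {κ : ℝ} (hκ : 0 ≤ κ) (α w : ℝ) (m : ℕ) :
    psi κ α m (κ ^ 2 * w) = κ * psi 1 α m w := by
  unfold psi
  rw [show 2 * (κ ^ 2 * w) * Real.log (2 / α) / m = κ ^ 2 * (2 * w * Real.log (2 / α) / m) by
    ring, Real.sqrt_mul (sq_nonneg κ), Real.sqrt_sq hκ]
  ring

/-- The empirical Bernstein inequality for variables with values in `[0, κ]`. -/
theorem measure_mean_add_psi_lt_le (hm : 2 ≤ m) (hX : ∀ i, Measurable (X i))
    (hind : iIndepFun X P) {κ : ℝ} (hκ : 0 < κ) (hb : ∀ i ω, X i ω ∈ Set.Icc (0 : ℝ) κ)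
    {μ s α : ℝ} (hμ : ∀ i, ∫ ω, X i ω ∂P = μ) (hs : ∀ i, ∫ ω, X i ω ^ 2 ∂P = s)
    (hα : 0 < α) (hα' : α < 2) :
    P.real {ω | vecMean (fun i => X i ω) + psi κ α m (empVar fun i => X i ω) < μ} ≤ α := by
  have h := measure_mean_add_psi_lt_le_of_mem_Icc (P := P) (X := fun i ω => κ⁻¹ * X i ω)
    (μ := κ⁻¹ * μ) (s := κ⁻¹ ^ 2 * s) hm (fun i => (hX i).const_mul _)
    (hind.comp (fun _ z => κ⁻¹ * z) fun _ => by fun_prop)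
    (fun i ω => ⟨mul_nonneg (by positivity) (hb i ω).1,
      by rw [inv_mul_le_one₀ hκ]; exact (hb i ω).2⟩)
    (fun i => by rw [integral_const_mul, hμ])
    (fun i => by simp only [mul_pow]; rw [integral_const_mul, hs]) hα hα'
  refine le_of_eq_of_le (congrArg P.real (Set.ext fun ω => ?_)) h
  have hX' : (fun i => X i ω) = fun i => κ * (κ⁻¹ * X i ω) := by
    ext i; field_simp
  rw [Set.mem_ofPred_eq, Set.mem_ofPred_eq, hX', vecMean_smul, empVar_smul, psi_smul hκ.le, ← mul_add, lt_inv_mul_iff₀ hκ]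

end EmpiricalBernstein

/-! ### Compactness of ellipsoids and existence of maximizers -/

section Ellipsoid

lemma isCompact_ellipsoid {m : ℕ} (c : Fin m → ℝ) (A : Matrix (Fin m) (Fin m) ℝ) :
    IsCompact (ellipsoid c A) := by
  have hball : IsCompact {u : Fin m → ℝ | ∑ i, u i ^ 2 ≤ 1} := by
    refine (isCompact_Icc (a := fun _ => (-1 : ℝ)) (b := fun _ => (1 : ℝ))).of_isClosed_subset
      (isClosed_le (by fun_prop) continuous_const) fun u hu => ?_
    have h : ∀ i, |u i| ≤ 1 := fun i => (sq_le_one_iff_abs_le_one _).mp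
      ((Finset.single_le_sum (f := fun i => u i ^ 2) (fun j _ => sq_nonneg _)
        (Finset.mem_univ i)).trans hu)
    exact ⟨fun i => (abs_le.mp (h i)).1, fun i => (abs_le.mp (h i)).2⟩
  have himage : ellipsoid c A = (fun u => c + A *ᵥ u) '' {u | ∑ i, u i ^ 2 ≤ 1} := by
    ext z
    simp only [ellipsoid, Set.mem_ofPred_eq, Set.mem_image, eq_comm]
  rw [himage]
  exact hball.image (continuous_const.add (continuous_const.matrix_mulVec continuous_id))

lemma ellipsoid_nonempty {m : ℕ} (c : Fin m → ℝ) (A : Matrix (Fin m) (Fin m) ℝ) :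
    (ellipsoid c A).Nonempty :=
  ⟨c, 0, by simp, by simp⟩

variable {d m : ℕ} (h : Inputs d → ℝ) (x : Fin m → Inputs d)

lemma continuous_vecMean_importanceVec :
    Continuous fun z => vecMean (importanceVec h x z) := by
  unfold vecMean importanceVec
  fun_prop

lemma continuous_empVar_importanceVec :
    Continuous fun z => empVar (importanceVec h x z) := by
  unfold empVar importanceVec
  fun_prop

lemma isGreatest_xiStar {Z : Set (Fin m → ℝ)} (hZ : IsCompact Z) (hne : Z.Nonempty) :
    IsGreatest ((fun z => vecMean (importanceVec h x z)) '' Z) (xiStar h x Z) :=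
  (hZ.image (continuous_vecMean_importanceVec h x)).isGreatest_sSup (hne.image _)

lemma exists_isVarMaximizer {Z : Set (Fin m → ℝ)} (hZ : IsCompact Z) (hne : Z.Nonempty) :
    ∃ z, IsVarMaximizer h x Z z :=
  hZ.exists_isMaxOn hne (continuous_empVar_importanceVec h x).continuousOn

end Ellipsoid

/-! ### Monotonicity of the Bernstein term -/

section BernsteinTerm

variable {κ α : ℝ} {m : ℕ}

lemma psi_mono (hα : 0 < α) (hα' : α < 1) {v w : ℝ} (hvw : v ≤ w) :
    psi κ α m v ≤ psi κ α m w := by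
  have hL : 0 ≤ Real.log (2 / α) := Real.log_nonneg (by rw [le_div_iff₀ hα]; linarith)
  unfold psi
  gcongr

lemma psi_le_psiScaled (hκ : 1 ≤ κ) (v : ℝ) : psi κ α m v ≤ psiScaled κ α m v := by
  unfold psi psiScaled
  rw [mul_add]
  gcongr
  exact le_mul_of_one_le_left (Real.sqrt_nonneg _) hκ

end BernsteinTerm

/-! ### Importance sampling in the regression model -/

section Model

variable {Ω : Type*} [MeasurableSpace Ω] {d n : ℕ} {P : Measure Ω} {η ϱ : ℝ}
  {f h : Inputs d → ℝ} {x : Fin n → Ω → Inputs d} {y ε : Fin n → Ω → ℝ}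
  {G : Subgroup (GL (Fin n) ℝ)}

lemma kernelNorm_sq (hf : MemLp f 2 volume) : kernelNorm f ^ 2 = ∫ s, f s ^ 2 := by
  have h := hf.eLpNorm_eq_integral_rpow_norm two_ne_zero ENNReal.ofNat_ne_top
  have hnn : 0 ≤ ∫ s, f s ^ 2 := integral_nonneg fun s => sq_nonneg _
  simp only [ENNReal.toReal_ofNat, Real.rpow_two, Real.norm_eq_abs, sq_abs] at h
  rw [kernelNorm, h, ENNReal.toReal_ofReal (Real.rpow_nonneg hnn _), ← Real.rpow_natCast,
    ← Real.rpow_mul hnn]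
  norm_num

/-- The importance weighted value `f(s)² / h(s)`. -/
noncomputable def importanceRatio (f h : Inputs d → ℝ) (s : Inputs d) : ℝ := f s ^ 2 / h s

namespace IsRegressionModel

variable (hmodel : IsRegressionModel P η ϱ f h x y ε G)
include hmodel

lemma measurable_importanceRatio : Measurable (importanceRatio f h) :=
  (hmodel.paleyWiener.continuous.measurable.pow_const 2).div hmodel.measurable_density

lemma importanceRatio_mem_Icc (s : Inputs d) : importanceRatio f h s ∈ Set.Icc 0 ϱ :=
  ⟨div_nonneg (sq_nonneg _) (hmodel.density_pos s).le,
    (div_le_iff₀ (hmodel.density_pos s)).mpr (hmodel.sq_le s)⟩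

/-- Importance sampling: the mean of the importance weighted values is the squared norm. -/
lemma integral_importanceRatio (k : Fin n) :
    ∫ ω, importanceRatio f h (x k ω) ∂P = kernelNorm f ^ 2 := by
  rw [kernelNorm_sq hmodel.paleyWiener.memLp,
    ← integral_map (hmodel.measurable_input k).aemeasurable
      hmodel.measurable_importanceRatio.aestronglyMeasurable,
    hmodel.law_input k, integral_withDensity_eq_integral_toReal_smul
      hmodel.measurable_density.ennreal_ofReal (ae_of_all _ fun s => ENNReal.ofReal_lt_top)]
  -- The density cancels pointwise because it vanishes nowhere.
  refine integral_congr_ae (ae_of_all _ fun s => ?_)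
  have hs := hmodel.density_pos s
  simp only [ENNReal.toReal_ofReal hs.le, smul_eq_mul, importanceRatio]
  field_simp

lemma iIndepFun_importanceRatio :
    iIndepFun (fun k ω => importanceRatio f h (x k ω)) P :=
  hmodel.indep.comp (fun _ p => importanceRatio f h p.1)
    fun _ => hmodel.measurable_importanceRatio.comp measurable_fst

lemma integral_importanceRatio_sq_congr (k l : Fin n) :
    ∫ ω, importanceRatio f h (x k ω) ^ 2 ∂P = ∫ ω, importanceRatio f h (x l ω) ^ 2 ∂P :=
  ((hmodel.identDistrib k l).comp
    ((hmodel.measurable_importanceRatio.comp measurable_fst).pow_const 2)).integral_eq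

/-- The empirical Bernstein bound for the squared norm, computed from the first `n₀` inputs and
the exact values of the regression function. -/
theorem measure_mean_add_psi_lt_kernelNorm_sq_le [IsProbabilityMeasure P] {n₀ : ℕ}
    (hn₀ : 2 ≤ n₀) (hn : n₀ ≤ n) {α : ℝ} (hα : 0 < α) (hα' : α < 2) :
    P.real {ω | vecMean (fun i => importanceRatio f h (x (Fin.castLE hn i) ω)) +
      psi ϱ α n₀ (empVar fun i => importanceRatio f h (x (Fin.castLE hn i) ω)) <
        kernelNorm f ^ 2} ≤ α :=
  measure_mean_add_psi_lt_le (X := fun i ω => importanceRatio f h (x (Fin.castLE hn i) ω)) hn₀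
    (fun _ => hmodel.measurable_importanceRatio.comp (hmodel.measurable_input _))
    (hmodel.iIndepFun_importanceRatio.precomp (Fin.castLE_injective hn)) hmodel.bound_pos
    (fun _ _ => hmodel.importanceRatio_mem_Icc _) (fun _ => hmodel.integral_importanceRatio _)
    (fun _ => hmodel.integral_importanceRatio_sq_congr _ (Fin.castLE hn ⟨0, by omega⟩)) hα hα'

end IsRegressionModel

end Model

/-- Up to a null set, `A ⊆ C ∪ B`. Only monotonicity and subadditivity are used, so no set has to be
measurable; this is what allows an arbitrary selection of maximizers `z*`. -/
lemma sub_le_measureReal_of_ae_imp {Ω : Type*} [MeasurableSpace Ω] {P : Measure Ω}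
    [IsFiniteMeasure P] {A B C : Set Ω} {a b : ℝ} (hA : a ≤ P.real A) (hB : P.real B ≤ b)
    (h : ∀ᵐ ω ∂P, ω ∈ A → ω ∉ B → ω ∈ C) : a - b ≤ P.real C := by
  have hnull : P.real {ω | ¬ (ω ∈ A → ω ∉ B → ω ∈ C)} = 0 := by
    rw [measureReal_eq_zero_iff]
    exact h
  have hsub : A ⊆ C ∪ B ∪ {ω | ¬ (ω ∈ A → ω ∉ B → ω ∈ C)} := by
    intro ω hω
    by_cases hB : ω ∈ B <;> by_cases hC : ω ∈ C <;> simp [hω, hB, hC]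
  have h1 := measureReal_mono (μ := P) hsub
  have h2 := measureReal_union_le (μ := P) (C ∪ B) {ω | ¬ (ω ∈ A → ω ∉ B → ω ∈ C)}
  have h3 := measureReal_union_le (μ := P) C B
  linarith

end KernelNormBound

theorem mainTheorem3 {Ω : Type*} [MeasurableSpace Ω] (P : Measure Ω) [IsProbabilityMeasure P]
    (d n n₀ : ℕ) (hn₀ : 2 ≤ n₀) (hn : n₀ ≤ n)
    (η ϱ : ℝ) (hη : 0 < η)
    (f h : KernelNormBound.Inputs d → ℝ)
    (x : Fin n → Ω → KernelNormBound.Inputs d) (y ε : Fin n → Ω → ℝ)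
    (G : Subgroup (GL (Fin n) ℝ))
    (hmodel : KernelNormBound.IsRegressionModel P η ϱ f h x y ε G)
    (α β : ℝ) (hα : 0 < α) (hα' : α < 1) (hβ : 0 ≤ β) (hβ' : β < 1)
    -- the inputs and outputs of the subsample of size `n₀`
    (x₀ : Ω → Fin n₀ → KernelNormBound.Inputs d)
    (hx₀ : ∀ ω k, x₀ ω k = x (Fin.castLE hn k) ω)
    (y₀ : Ω → Fin n₀ → ℝ) (hy₀ : ∀ ω k, y₀ ω k = y (Fin.castLE hn k) ω)
    -- the confidence ellipsoid
    (Z : Ω → Set (Fin n₀ → ℝ)) (hZ : KernelNormBound.IsRandomEllipsoid Z)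
    (hcover : 1 - β ≤ P.real {ω | (fun k => f (x₀ ω k)) ∈ Z ω}) :
    -- both maximization problems have optimal solutions
    (∀ ω, IsGreatest
        ((fun z => KernelNormBound.vecMean (KernelNormBound.importanceVec h (x₀ ω) z)) '' Z ω)
        (KernelNormBound.xiStar h (x₀ ω) (Z ω)) ∧
      ∃ z, KernelNormBound.IsVarMaximizer h (x₀ ω) (Z ω) z) ∧
    -- the bound `τ_e`
    (∀ zstar : Ω → Fin n₀ → ℝ,
      (∀ ω, KernelNormBound.IsVarMaximizer h (x₀ ω) (Z ω) (zstar ω)) →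
      1 - α - β ≤ P.real {ω | KernelNormBound.kernelNorm f ^ 2 ≤
          KernelNormBound.xiStar h (x₀ ω) (Z ω) +
            KernelNormBound.psi ϱ α n₀ (KernelNormBound.empVar
              (KernelNormBound.importanceVec h (x₀ ω) (zstar ω)))} ∧
      (1 ≤ ϱ → 1 - α - β ≤ P.real {ω | KernelNormBound.kernelNorm f ^ 2 ≤
          KernelNormBound.xiStar h (x₀ ω) (Z ω) +
            KernelNormBound.psiScaled ϱ α n₀ (KernelNormBound.empVar
              (KernelNormBound.importanceVec h (x₀ ω) (zstar ω)))})) ∧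
    -- the bound `τ_b` in the noise-free case
    ((∀ k, ∀ᵐ ω ∂P, ε k ω = 0) →
      1 - α - β ≤ P.real {ω | KernelNormBound.kernelNorm f ^ 2 ≤
          KernelNormBound.xiStar h (x₀ ω) (Z ω) +
            KernelNormBound.psi ϱ α n₀ (KernelNormBound.empVar
              (KernelNormBound.importanceVec h (x₀ ω) (y₀ ω)))} ∧
      (1 ≤ ϱ → 1 - α - β ≤ P.real {ω | KernelNormBound.kernelNorm f ^ 2 ≤
          KernelNormBound.xiStar h (x₀ ω) (Z ω) +
            KernelNormBound.psiScaled ϱ α n₀ (KernelNormBound.empVar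
              (KernelNormBound.importanceVec h (x₀ ω) (y₀ ω)))})) := by
  have hcomp : ∀ ω, IsCompact (Z ω) ∧ (Z ω).Nonempty := by
    obtain ⟨c, A, -, -, hcA⟩ := hZ
    exact fun ω => hcA ω ▸ ⟨KernelNormBound.isCompact_ellipsoid _ _,
      KernelNormBound.ellipsoid_nonempty _ _⟩
  have hgreatest := fun ω =>
    KernelNormBound.isGreatest_xiStar h (x₀ ω) (hcomp ω).1 (hcomp ω).2
  have hbern := hmodel.measure_mean_add_psi_lt_kernelNorm_sq_le hn₀ hn hα (hα'.trans one_lt_two)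
  have hratio : ∀ ω, (fun i => KernelNormBound.importanceRatio f h (x (Fin.castLE hn i) ω)) =
      KernelNormBound.importanceVec h (x₀ ω) fun k => f (x₀ ω k) := fun ω => by
    ext k
    simp only [KernelNormBound.importanceRatio, KernelNormBound.importanceVec, hx₀]
  simp only [hratio] at hbern
  -- Common core of all four bounds: the deviation term need only dominate the one at the exact
  -- values of `f`, almost surely on the covering event.
  have hbound : ∀ ψ : Ω → ℝ, (∀ᵐ ω ∂P, (fun k => f (x₀ ω k)) ∈ Z ω →
      KernelNormBound.psi ϱ α n₀ (KernelNormBound.empVar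
        (KernelNormBound.importanceVec h (x₀ ω) fun k => f (x₀ ω k))) ≤ ψ ω) →
      1 - α - β ≤ P.real {ω | KernelNormBound.kernelNorm f ^ 2 ≤
        KernelNormBound.xiStar h (x₀ ω) (Z ω) + ψ ω} := by
    intro ψ hψ
    rw [sub_right_comm]
    refine KernelNormBound.sub_le_measureReal_of_ae_imp hcover hbern ?_
    filter_upwards [hψ] with ω hω hmem hlt
    have h1 := (hgreatest ω).2 (Set.mem_image_of_mem _ hmem)
    have h2 := hω hmem
    simp only [not_lt] at hlt ⊢
    linarith
  refine ⟨fun ω => ⟨hgreatest ω, KernelNormBound.exists_isVarMaximizer h (x₀ ω) (hcomp ω).1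
    (hcomp ω).2⟩, fun zstar hzstar => ?_, fun hnoise => ?_⟩
  · have hle : ∀ ω, (fun k => f (x₀ ω k)) ∈ Z ω →
        KernelNormBound.psi ϱ α n₀ (KernelNormBound.empVar
          (KernelNormBound.importanceVec h (x₀ ω) fun k => f (x₀ ω k))) ≤
        KernelNormBound.psi ϱ α n₀ (KernelNormBound.empVar
          (KernelNormBound.importanceVec h (x₀ ω) (zstar ω))) := fun ω hmem =>
      KernelNormBound.psi_mono hα hα' ((hzstar ω).2 _ hmem)
    exact ⟨hbound _ (ae_of_all _ hle), fun hϱ => hbound _ (ae_of_all _ fun ω hmem =>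
      (hle ω hmem).trans (KernelNormBound.psi_le_psiScaled hϱ _))⟩
  -- Without noise the outputs are the exact values of `f`, so the empirical variance is observed
  -- and needs no maximization.
  · have heq : ∀ᵐ ω ∂P, (fun k => f (x₀ ω k)) = y₀ ω := by
      filter_upwards [ae_all_iff.mpr hnoise] with ω hω
      ext k
      rw [hy₀, hx₀, hmodel.output_eq, hω, add_zero]
    refine ⟨hbound _ ?_, fun hϱ => hbound _ ?_⟩
    · filter_upwards [heq] with ω hω _
      rw [hω]
    · filter_upwards [heq] with ω hω _
      rw [hω]
      exact KernelNormBound.psi_le_psiScaled hϱ _
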